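/- For a finite group $G$ and a commutative ring $R$, an $RG$-lattice is an $RG$-module that is free of finite rank over $R$; a permutation module is an $RG$-lattice possessing an $R$-basis that is preserved as a set by every element of $G$. For a normal subgroup $N$ of $G$ and an $RG$-module $U$, let $U^N=\{u\in U : hu=u \text{ for all } h\in N\}$ and $U_N=U/\langle hu-u : h\in N,\ u\in U\rangle$, regarded as $R[G/N]$-modules. Let $G=C_2\times C_2\times C_2=\langle n\rangle\times\langle b\rangle\times\langle c\rangle$ and $N=\langle n\rangle$. There is a $\mathbb{Z}_2G$-lattice $U=\mathbb{Z}_2^{11}$ (column vectors) on which $n,b,c$ act by left multiplication by the respective matrices $$n:\quad \begin{pmatrix} 1 & 0 & 0 & 0 & 0 & 0 & 0 & 0 & 0 & 0 & 0 \\ 0 & 1 & 0 & 0 & 0 & 0 & 0 & 0 & 0 & 0 & 0 \\ 0 & 0 & 1 & 0 & 0 & 0 & 0 & 0 & 0 & 0 & 0 \\ 0 & 0 & 0 & 1 & 0 & 0 & 0 & 0 & 0 & 0 & 0 \\ 0 & 1 & 0 & 0 & 1 & 0 & 0 & 1 & 1 & 1 & 1 \\ 0 & 1 & 0 & 0 &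 0 & 1 & 0 & 1 & 1 & 1 & 1 \\ 0 & -1 & 0 & 0 & 0 & 0 & 1 & -1 & -1 & -1 & -1 \\ 0 & -1 & 0 & 0 & 0 & 0 & 0 & -1 & 0 & 0 & 0 \\ 0 & 0 & -1 & 1 & 0 & 0 & 0 & 0 & -1 & 0 & 0 \\ 0 & -1 & 1 & 0 & 0 & 0 & 0 & 0 & 0 & -1 & 0 \\ 0 & 0 & 0 & -1 & 0 & 0 & 0 & 0 & 0 & 0 & -1 \end{pmatrix},$$ $$b:\quad \begin{pmatrix} 1 & 0 & 0 & 0 & 0 & 0 & 0 & 0 & 0 & 0 & 0 \\ 0 & 1 & 0 & 0 & 0 & 0 & 0 & 0 & 0 & 0 & 0 \\ 0 & 0 & 1 & 0 & 0 & 0 & 0 & 0 & 0 & 0 & 0 \\ 0 & 0 & 0 & 1 & 0 & 0 & 0 & 0 & 0 & 0 & 0 \\ 0 & 0 & 0 & 1 & 0 & 1 & 0 & 0 & 0 & 1 & 1 \\ 0 & 1 & -1 & 0 & 1 & 0 & 0 & 0 & 0 & 1 & 1 \\ 1 & 0 & 1 & -1 & -1 & -1 & -1 & 0 & 0 & -1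 & -1 \\ 0 & 0 & 0 & 0 & 0 & 0 & 0 & 1 & 0 & 0 & 0 \\ 0 & 0 & 0 & 0 & 0 & 0 & 0 & 0 & 1 & 0 & 0 \\ 0 & -1 & 1 & 0 & 0 & 0 & 0 & 0 & 0 & -1 & 0 \\ 0 & 0 & 0 & -1 & 0 & 0 & 0 & 0 & 0 & 0 & -1 \end{pmatrix},$$ $$c:\quad \begin{pmatrix} 1 & 0 & 0 & 0 & 0 & 0 & 0 & 0 & 0 & 0 & 0 \\ 0 & 1 & 0 & 0 & 0 & 0 & 0 & 0 & 0 & 0 & 0 \\ 0 & 0 & 1 & 0 & 0 & 0 & 0 & 0 & 0 & 0 & 0 \\ 0 & 0 & 0 & 1 & 0 & 0 & 0 & 0 & 0 & 0 & 0 \\ 0 & 0 & 0 & 1 & 0 & 0 & 1 & -1 & 0 & -1 & 0 \\ 1 & 1 & 0 & 0 & -1 & -1 & -1 & -1 & 0 & -1 & 0 \\ 0 & 0 & 0 & -1 & 1 & 0 & 0 & 1 & 0 & 1 & 0 \\ 0 & 0 & 0 & 0 & 0 & 0 & 0 & 1 & 0 & 0 & 0 \\ 0 & 0 & -1 & 1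 & 0 & 0 & 0 & 0 & -1 & 0 & 0 \\ 0 & 0 & 0 & 0 & 0 & 0 & 0 & 0 & 0 & 1 & 0 \\ 0 & 0 & 0 & -1 & 0 & 0 & 0 & 0 & 0 & 0 & -1 \end{pmatrix}.$$ For this lattice, $U^N$ and $U_N$ are permutation $\mathbb{Z}_2[G/N]$-modules, but $U$ is not a permutation $\mathbb{Z}_2G$-module. In particular, for this $G$ and $N$ it is not true that a $\mathbb{Z}_2G$-lattice $U$ is a permutation module if and only if both $U^N$ and $U_N$ are permutation $\mathbb{Z}_2[G/N]$-modules. That is, in the criterion "$U$ is a permutation module if and only if (1) $U^N$ and $U_N$ are permutation $\mathbb{Z}_2[G/N]$-modules and (2) $(U/U^N)_N$ is a permutation $\mathbb{F}_2[G/N]$-module", condition (2) cannot be omitted. -/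

import Mathlib

/-- A representation `ρ` of a group `G` over `k` is a permutation lattice if the underlying module
has a finite `k`-basis which, as a set, is preserved by every element of `G`. -/
def IsPermutationLattice {k G V : Type*} [CommRing k] [Group G] [AddCommGroup V] [Module k V]
    (ρ : Representation k G V) : Prop :=
  ∃ (r : ℕ) (e : Module.Basis (Fin r) k V), ∀ (g : G) (i : Fin r), ∃ j : Fin r, ρ g (e i) = e j

/-- The group `C₂ × C₂ × C₂`. -/
abbrev CTwoCubed : Type :=
  Multiplicative (ZMod 2) × Multiplicative (ZMod 2) × Multiplicative (ZMod 2)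

namespace CTwoCubed

/-- The generator `n` of the first factor. -/
def n : CTwoCubed := (Multiplicative.ofAdd 1, 1, 1)

/-- The generator `b` of the second factor. -/
def b : CTwoCubed := (1, Multiplicative.ofAdd 1, 1)

/-- The generator `c` of the third factor. -/
def c : CTwoCubed := (1, 1, Multiplicative.ofAdd 1)

/-- The subgroup `N = ⟨n⟩` of order `2`. -/
def N : Subgroup CTwoCubed := Subgroup.zpowers n

instance : N.Normal := inferInstanceAs (Subgroup.zpowers n).Normal

/-- The integral matrix by which `n` acts. -/
def matN : Matrix (Fin 11) (Fin 11) ℤ :=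
  !![1, 0, 0, 0, 0, 0, 0, 0, 0, 0, 0;
    0, 1, 0, 0, 0, 0, 0, 0, 0, 0, 0;
    0, 0, 1, 0, 0, 0, 0, 0, 0, 0, 0;
    0, 0, 0, 1, 0, 0, 0, 0, 0, 0, 0;
    0, 1, 0, 0, 1, 0, 0, 1, 1, 1, 1;
    0, 1, 0, 0, 0, 1, 0, 1, 1, 1, 1;
    0, -1, 0, 0, 0, 0, 1, -1, -1, -1, -1;
    0, -1, 0, 0, 0, 0, 0, -1, 0, 0, 0;
    0, 0, -1, 1, 0, 0, 0, 0, -1, 0, 0;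
    0, -1, 1, 0, 0, 0, 0, 0, 0, -1, 0;
    0, 0, 0, -1, 0, 0, 0, 0, 0, 0, -1]

/-- The integral matrix by which `b` acts. -/
def matB : Matrix (Fin 11) (Fin 11) ℤ :=
  !![1, 0, 0, 0, 0, 0, 0, 0, 0, 0, 0;
    0, 1, 0, 0, 0, 0, 0, 0, 0, 0, 0;
    0, 0, 1, 0, 0, 0, 0, 0, 0, 0, 0;
    0, 0, 0, 1, 0, 0, 0, 0, 0, 0, 0;
    0, 0, 0, 1, 0, 1, 0, 0, 0, 1, 1;
    0, 1, -1, 0, 1, 0, 0, 0, 0, 1, 1;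
    1, 0, 1, -1, -1, -1, -1, 0, 0, -1, -1;
    0, 0, 0, 0, 0, 0, 0, 1, 0, 0, 0;
    0, 0, 0, 0, 0, 0, 0, 0, 1, 0, 0;
    0, -1, 1, 0, 0, 0, 0, 0, 0, -1, 0;
    0, 0, 0, -1, 0, 0, 0, 0, 0, 0, -1]

/-- The integral matrix by which `c` acts. -/
def matC : Matrix (Fin 11) (Fin 11) ℤ :=
  !![1, 0, 0, 0, 0, 0, 0, 0, 0, 0, 0;
    0, 1, 0, 0, 0, 0, 0, 0, 0, 0, 0;
    0, 0, 1, 0, 0, 0, 0, 0, 0, 0, 0;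
    0, 0, 0, 1, 0, 0, 0, 0, 0, 0, 0;
    0, 0, 0, 1, 0, 0, 1, -1, 0, -1, 0;
    1, 1, 0, 0, -1, -1, -1, -1, 0, -1, 0;
    0, 0, 0, -1, 1, 0, 0, 1, 0, 1, 0;
    0, 0, 0, 0, 0, 0, 0, 1, 0, 0, 0;
    0, 0, -1, 1, 0, 0, 0, 0, -1, 0, 0;
    0, 0, 0, 0, 0, 0, 0, 0, 0, 1, 0;
    0, 0, 0, -1, 0, 0, 0, 0, 0, 0, -1]

end CTwoCubed

/-! ### Integral matrix identities and the group action. -/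

namespace CTwoCubed

/-! The positive half rests on explicit permutation bases of the `n`-invariants and
`n`-coinvariants. Integer matrices, including a generalized inverse of `1 - matN`, certify them, so
they work over every commutative ring.

The negative half is an obstruction modulo 2. There `(n - 1)(b - 1)` and `(n - 1)(c - 1)` have rank
one with the same image, spanned by `s = socleVec`; they equal `s * formB` and `s * formC`, with
both forms fixed by the group. Suppose a basis is permuted. If `formB` or `formC` is nonzero on a
basis vector, then `s` is a sum of four translates of that vector, so every basis vector in the
support of `s` lies in its orbit. The pair `(formB, formC)` is constant on orbits, hence takes at
most one nonzero value on the basis. Some nonzero combination of the forms then vanishes on the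
basis, contradicting their independence (`not_permutes_basis_modTwo`). A permutation basis over the
2-adic integers would reduce to such a basis. -/

/-- The columns form a permutation basis of the lattice of `n`-invariants. -/
def invBasis : Matrix (Fin 11) (Fin 7) ℤ :=
  !![1, 1, 1, 1, 0, 0, 0;
    0, 0, 0, 0, 2, 0, 0;
    0, 0, 0, 0, 2, -2, 0;
    0, 0, 0, 0, 0, 0, 2;
    1, 0, 0, 0, 1, 0, 1;
    0, 0, 0, 1, 1, 1, 0;
    0, 1, 0, 0, 0, -1, -1;
    0, 0, 0, 0, -1, 0, 0;
    0, 0, 0, 0, -1, 1, 1;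
    0, 0, 0, 0, 0, -1, 0;
    0, 0, 0, 0, 0, 0, -1]

/-- Coordinates of `n`-invariants with respect to the columns of `invBasis`. -/
def invCoord : Matrix (Fin 7) (Fin 11) ℤ :=
  !![0, 0, 0, 0, 1, 0, 0, 0, 1, 1, 2;
    0, 0, 0, 0, 0, 0, 1, 0, 0, -1, -1;
    1, 0, 0, 0, -1, -1, -1, 0, -2, -2, -2;
    0, 0, 0, 0, 0, 1, 0, 0, 1, 2, 1;
    0, 0, 0, 0, 0, 0, 0, 0, -1, -1, -1;
    0, 0, 0, 0, 0, 0, 0, 0, 0, -1, 0;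
    0, 0, 0, 0, 0, 0, 0, 0, 0, 0, -1]

/-- The columns represent a permutation basis of the lattice of `n`-coinvariants. -/
def coinvBasis : Matrix (Fin 11) (Fin 7) ℤ :=
  !![1, 1, 1, 1, 1, 1, 0;
    -1, -1, -1, -1, 0, 0, 1;
    -1, -1, 0, 0, -1, -1, 0;
    0, 0, 0, 0, 0, 0, 1;
    0, 0, 0, 0, 0, 0, 0;
    0, 0, 0, -1, 0, 1, 0;
    0, 0, 0, 1, 0, 0, 0;
    0, 0, 0, 0, 0, 0, 0;
    0, 0, 0, 0, 0, 0, 0;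
    0, 0, 0, 0, 0, 0, 0;
    0, 1, 0, 1, 1, 0, 1]

/-- Coordinates of `n`-coinvariants with respect to the columns of `coinvBasis`. -/
def coinvCoord : Matrix (Fin 7) (Fin 11) ℤ :=
  !![0, 0, -1, 1, -1, -1, 0, -1, -1, -1, -1;
    -1, -1, 0, 0, 1, 1, 0, 1, 1, 1, 1;
    1, 0, 1, 0, -1, 0, -1, 0, 0, 0, 0;
    0, 0, 0, 0, 1, 0, 1, 0, 0, 0, 0;
    1, 1, 0, -1, 0, -1, -1, 0, 0, 0, 0;
    0, 0, 0, 0, 0, 1, 1, 0, 0, 0, 0;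
    0, 0, 0, 1, 0, 0, 0, 0, 0, 0, 0]

/-- An integral generalized inverse of `1 - matN`. -/
def splitting : Matrix (Fin 11) (Fin 11) ℤ :=
  !![0, 0, 0, 0, 0, 0, 0, 0, 0, 0, 0;
    0, 0, 0, 0, -2, 0, 0, -1, 0, 0, 0;
    0, 0, 0, 0, -2, 0, 0, -1, 0, -1, 0;
    0, 0, 0, 0, -2, 0, 0, -1, -1, -1, 0;
    0, 0, 0, 0, 0, 0, 0, 0, 0, 0, 0;
    0, 0, 0, 0, 0, 0, 0, 0, 0, 0, 0;
    0, 0, 0, 0, 0, 0, 0, 0, 0, 0, 0;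
    0, 0, 0, 0, 1, 0, 0, 1, 0, 0, 0;
    0, 0, 0, 0, 0, 0, 0, 0, 0, 0, 0;
    0, 0, 0, 0, 0, 0, 0, 0, 0, 0, 0;
    0, 0, 0, 0, 0, 0, 0, 0, 0, 0, 0]

theorem invCoord_mul_invBasis : invCoord * invBasis = 1 := by decide +kernel

/-- The correction term vanishes on vectors fixed by `n`, so the columns of `invBasis` span the
invariants. -/
theorem invBasis_mul_invCoord : invBasis * invCoord = 1 + splitting * (matN - 1) := by
  decide +kernel

theorem matN_mul_invBasis : matN * invBasis = invBasis := by decide +kernel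

theorem matB_mul_invBasis :
    matB * invBasis = invBasis.submatrix id ![3, 2, 1, 0, 4, 5, 6] := by decide +kernel

theorem matC_mul_invBasis :
    matC * invBasis = invBasis.submatrix id ![1, 0, 3, 2, 4, 5, 6] := by decide +kernel

theorem coinvCoord_mul_coinvBasis : coinvCoord * coinvBasis = 1 := by decide +kernel

/-- Dual to the case of invariants: the correction term has image in that of `n - 1`, so it dies in
the coinvariants. -/
theorem coinvBasis_mul_coinvCoord :
    coinvBasis * coinvCoord = 1 + (matN - 1) * splitting := by decide +kernel

theorem coinvCoord_mul_matN : coinvCoord * matN = coinvCoord := by decide +kernel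

/-- The columns of `coinvBasis` are only representatives, permuted modulo the image of `n - 1`;
hence the projection by `coinvCoord` on the left. -/
theorem coinvCoord_mul_matB_mul_coinvBasis : coinvCoord * matB * coinvBasis =
    (1 : Matrix (Fin 7) (Fin 7) ℤ).submatrix id ![0, 1, 3, 2, 5, 4, 6] := by decide +kernel

theorem coinvCoord_mul_matC_mul_coinvBasis : coinvCoord * matC * coinvBasis =
    (1 : Matrix (Fin 7) (Fin 7) ℤ).submatrix id ![1, 0, 2, 3, 5, 4, 6] := by decide +kernel

theorem matN_sq : matN ^ 2 = 1 := by decide +kernel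

theorem matB_sq : matB ^ 2 = 1 := by decide +kernel

theorem matC_sq : matC ^ 2 = 1 := by decide +kernel

theorem commute_matN_matB : Commute matN matB := by
  unfold Commute SemiconjBy; decide +kernel

theorem commute_matN_matC : Commute matN matC := by
  unfold Commute SemiconjBy; decide +kernel

theorem commute_matB_matC : Commute matB matC := by
  unfold Commute SemiconjBy; decide +kernel

/-- The monoid homomorphism from `C₂` that sends the generator to an element of square one. -/
def homOfSqEqOne {M : Type*} [Monoid M] (a : M) (ha : a ^ 2 = 1) :
    Multiplicative (ZMod 2) →* M where
  toFun x := a ^ x.toAdd.val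
  map_one' := by simp
  map_mul' x y := by
    rw [← pow_add, toAdd_mul, ZMod.val_add, ← pow_eq_pow_mod _ ha]

/-- The action of `C₂ × C₂ × C₂` by integral matrices. -/
def matHom : CTwoCubed →* Matrix (Fin 11) (Fin 11) ℤ :=
  (homOfSqEqOne matN matN_sq).noncommCoprod
    ((homOfSqEqOne matB matB_sq).noncommCoprod (homOfSqEqOne matC matC_sq)
      fun _ _ => commute_matB_matC.pow_pow _ _)
    fun _ _ => (commute_matN_matB.pow_pow _ _).mul_right (commute_matN_matC.pow_pow _ _)

theorem matHom_n : matHom n = matN := by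
  simp [matHom, n, homOfSqEqOne, ZMod.val_one]

theorem matHom_b : matHom b = matB := by
  simp [matHom, b, homOfSqEqOne, ZMod.val_one]

theorem matHom_c : matHom c = matC := by
  simp [matHom, c, homOfSqEqOne, ZMod.val_one]

theorem induction_on {p : CTwoCubed → Prop} (one : p 1) (hn : p n) (hb : p b) (hc : p c)
    (mul : ∀ g h, p g → p h → p (g * h)) (g : CTwoCubed) : p g := by
  have pow : ∀ g, p g → ∀ k : ℕ, p (g ^ k) := fun g hg k => by
    induction k with
    | zero => simpa using one
    | succ k ih => rw [pow_succ]; exact mul _ _ ih hg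
  have hg : g = n ^ g.1.toAdd.val * (b ^ g.2.1.toAdd.val * c ^ g.2.2.toAdd.val) := by
    revert g; decide
  rw [hg]
  exact mul _ _ (pow _ hn _) (mul _ _ (pow _ hb _) (pow _ hc _))

theorem mem_N_iff {g : CTwoCubed} : g ∈ N ↔ g = 1 ∨ g = n := by
  constructor
  · rintro ⟨k, rfl⟩
    have h2 : n ^ (2 : ℤ) = 1 := by decide
    rcases Int.even_or_odd' k with ⟨m, rfl | rfl⟩
    · left; simp only [zpow_mul, h2, one_zpow]
    · right; simp only [zpow_add, zpow_mul, h2, one_zpow, one_mul, zpow_one]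
  · rintro (rfl | rfl)
    · exact N.one_mem
    · exact Subgroup.mem_zpowers n

/-! ### The lattice over a general base ring, its invariants and coinvariants. -/

section Lattice

variable (k : Type*) [CommRing k]

/-- The lattice `k ^ 11` on which `C₂ × C₂ × C₂` acts by the given matrices. -/
noncomputable def lattice : Representation k CTwoCubed (Fin 11 → k) :=
  (Matrix.toLinAlgEquiv' : Matrix (Fin 11) (Fin 11) k ≃ₐ[k] _).toAlgHom.toMonoidHom.comp
    ((Int.castRingHom k).mapMatrix.toMonoidHom.comp matHom)

variable {k}

theorem lattice_apply (g : CTwoCubed) (v : Fin 11 → k) :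
    lattice k g v = ((matHom g).map (Int.cast : ℤ → k)).mulVec v := rfl

theorem toMatrix'_lattice (g : CTwoCubed) :
    LinearMap.toMatrix' (lattice k g) = (matHom g).map (Int.cast : ℤ → k) :=
  LinearMap.toMatrix'_toLin' _

theorem map_intCast_mul {l m o : Type*} [Fintype m] (A : Matrix l m ℤ) (B : Matrix m o ℤ) :
    (A * B).map (Int.cast : ℤ → k) =
      A.map (Int.cast : ℤ → k) * B.map (Int.cast : ℤ → k) :=
  Matrix.map_mul (f := Int.castRingHom k)

theorem lattice_apply_mulVec {l : Type*} [Fintype l] (g : CTwoCubed) (A : Matrix (Fin 11) l ℤ)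
    (v : l → k) : lattice k g ((A.map (Int.cast : ℤ → k)).mulVec v) =
      ((matHom g * A).map (Int.cast : ℤ → k)).mulVec v := by
  rw [lattice_apply, Matrix.mulVec_mulVec, map_intCast_mul]

theorem mulVec_lattice_apply {l : Type*} (g : CTwoCubed) (A : Matrix l (Fin 11) ℤ)
    (v : Fin 11 → k) : (A.map (Int.cast : ℤ → k)).mulVec (lattice k g v) =
      ((A * matHom g).map (Int.cast : ℤ → k)).mulVec v := by
  rw [lattice_apply, Matrix.mulVec_mulVec, map_intCast_mul]

theorem mulVec_matN_sub_one (v : Fin 11 → k) :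
    ((matN - 1).map (Int.cast : ℤ → k)).mulVec v = lattice k n v - v := by
  rw [lattice_apply, matHom_n, Matrix.map_sub _ Int.cast_sub, Matrix.map_one _ Int.cast_zero
    Int.cast_one, Matrix.sub_mulVec, Matrix.one_mulVec]

theorem mem_invariants_iff {v : Fin 11 → k} :
    v ∈ Representation.invariants ((lattice k).comp N.subtype) ↔ lattice k n v = v := by
  constructor
  · intro h
    exact h ⟨n, Subgroup.mem_zpowers n⟩
  · rintro h ⟨g, hg⟩
    rcases mem_N_iff.1 hg with rfl | rfl
    · simp
    · exact h

/-- Coordinates on the invariants of `N` in the lattice. -/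
noncomputable def invariantsEquiv :
    Representation.invariants ((lattice k).comp N.subtype) ≃ₗ[k] (Fin 7 → k) where
  __ := (invCoord.map (Int.cast : ℤ → k)).mulVecLin ∘ₗ Submodule.subtype _
  invFun v := ⟨(invBasis.map (Int.cast : ℤ → k)).mulVec v, by
    rw [mem_invariants_iff, lattice_apply_mulVec, matHom_n, matN_mul_invBasis]⟩
  left_inv v := by
    have hv := mulVec_matN_sub_one v.1
    rw [mem_invariants_iff.1 v.2, sub_self] at hv
    ext1
    simp only [LinearMap.toFun_eq_coe, LinearMap.comp_apply, Submodule.subtype_apply,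
      Matrix.mulVecLin_apply, Matrix.mulVec_mulVec]
    rw [← map_intCast_mul, invBasis_mul_invCoord, Matrix.map_add _ Int.cast_add, Matrix.add_mulVec,
      map_intCast_mul, ← Matrix.mulVec_mulVec, hv, Matrix.mulVec_zero, add_zero,
      Matrix.map_one _ Int.cast_zero Int.cast_one, Matrix.one_mulVec]
  right_inv v := by
    simp only [LinearMap.toFun_eq_coe, LinearMap.comp_apply, Submodule.subtype_apply,
      Matrix.mulVecLin_apply, Matrix.mulVec_mulVec]
    rw [← map_intCast_mul, invCoord_mul_invBasis, Matrix.map_one _ Int.cast_zero Int.cast_one,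
      Matrix.one_mulVec]

theorem coe_invariantsEquiv_symm_single (i : Fin 7) :
    ((invariantsEquiv (k := k)).symm (Pi.single i 1) : Fin 11 → k) =
      (invBasis.map (Int.cast : ℤ → k)).col i :=
  Matrix.mulVec_single_one (invBasis.map (Int.cast : ℤ → k)) i

/-- A representation of a quotient of `C₂ × C₂ × C₂` by `N` is a permutation lattice as soon as
the images of `b` and `c` permute a basis. -/
theorem isPermutationLattice_of_basis {V : Type*} [AddCommGroup V] [Module k V]
    (ρ : Representation k (CTwoCubed ⧸ N) V) {r : ℕ} (e : Module.Basis (Fin r) k V)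
    (σ τ : Fin r → Fin r) (hσ : ∀ i, ρ (b : CTwoCubed ⧸ N) (e i) = e (σ i))
    (hτ : ∀ i, ρ (c : CTwoCubed ⧸ N) (e i) = e (τ i)) : IsPermutationLattice ρ := by
  refine ⟨r, e, fun g => ?_⟩
  induction g using QuotientGroup.induction_on with | _ g
  induction g using induction_on with
  | one => exact fun i => ⟨i, by simp⟩
  | hn =>
    have : ((n : CTwoCubed) : CTwoCubed ⧸ N) = 1 :=
      (QuotientGroup.eq_one_iff _).2 (Subgroup.mem_zpowers n)
    exact fun i => ⟨i, by simp [this]⟩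
  | hb => exact fun i => ⟨_, hσ i⟩
  | hc => exact fun i => ⟨_, hτ i⟩
  | mul g h hg hh =>
    intro i
    obtain ⟨j, hj⟩ := hh i
    obtain ⟨l, hl⟩ := hg j
    exact ⟨l, by rw [QuotientGroup.mk_mul, map_mul, Module.End.mul_apply, hj, hl]⟩

theorem isPermutationLattice_quotientToInvariants :
    IsPermutationLattice ((lattice k).quotientToInvariants N) := by
  refine isPermutationLattice_of_basis _ (Module.Basis.ofEquivFun invariantsEquiv)
    ![3, 2, 1, 0, 4, 5, 6] ![1, 0, 3, 2, 4, 5, 6] (fun i => ?_) (fun i => ?_)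
  all_goals
    apply Subtype.ext
    simp only [Module.Basis.coe_ofEquivFun]
    rw [coe_invariantsEquiv_symm_single]
    refine (congrArg (lattice k _) (coe_invariantsEquiv_symm_single i)).trans ?_
    rw [← Matrix.mulVec_single_one, lattice_apply_mulVec]
  · rw [matHom_b, matB_mul_invBasis, Matrix.mulVec_single_one]
    rfl
  · rw [matHom_c, matC_mul_invBasis, Matrix.mulVec_single_one]
    rfl

/-- Coordinates on the coinvariants of `N` in the lattice. -/
noncomputable def coinvariantsEquiv :
    Representation.Coinvariants ((lattice k).comp N.subtype) ≃ₗ[k] (Fin 7 → k) where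
  __ := Representation.Coinvariants.lift _ (coinvCoord.map (Int.cast : ℤ → k)).mulVecLin (by
    rintro ⟨g, hg⟩
    ext1 i
    apply LinearMap.ext
    intro v
    rcases mem_N_iff.1 hg with rfl | rfl
    · simp
    · simp [mulVec_lattice_apply, matHom_n, coinvCoord_mul_matN])
  invFun v := Representation.Coinvariants.mk _ ((coinvBasis.map (Int.cast : ℤ → k)).mulVec v)
  left_inv v := by
    induction v using Representation.Coinvariants.induction_on with | _ v
    simp only [LinearMap.toFun_eq_coe, Representation.Coinvariants.lift_mk,
      Matrix.mulVecLin_apply, Matrix.mulVec_mulVec]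
    rw [← map_intCast_mul, coinvBasis_mul_coinvCoord, Matrix.map_add _ Int.cast_add,
      Matrix.add_mulVec, map_intCast_mul, ← Matrix.mulVec_mulVec, mulVec_matN_sub_one,
      Matrix.map_one _ Int.cast_zero Int.cast_one, Matrix.one_mulVec, map_add, map_sub]
    have := Representation.Coinvariants.mk_self_apply ((lattice k).comp N.subtype)
      ⟨n, Subgroup.mem_zpowers n⟩ ((splitting.map (Int.cast : ℤ → k)).mulVec v)
    exact add_eq_left.2 (sub_eq_zero.2 this)
  right_inv v := by
    simp only [LinearMap.toFun_eq_coe, Representation.Coinvariants.lift_mk,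
      Matrix.mulVecLin_apply, Matrix.mulVec_mulVec]
    rw [← map_intCast_mul, coinvCoord_mul_coinvBasis, Matrix.map_one _ Int.cast_zero Int.cast_one,
      Matrix.one_mulVec]

theorem isPermutationLattice_quotientToCoinvariants :
    IsPermutationLattice ((lattice k).quotientToCoinvariants N) := by
  have key : ∀ (g : CTwoCubed) (σ : Fin 7 → Fin 7), coinvCoord * matHom g * coinvBasis =
      (1 : Matrix (Fin 7) (Fin 7) ℤ).submatrix id σ → ∀ i,
      (lattice k).quotientToCoinvariants N (g : CTwoCubed ⧸ N)
        (Module.Basis.ofEquivFun coinvariantsEquiv i) =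
          Module.Basis.ofEquivFun coinvariantsEquiv (σ i) := by
    intro g σ h i
    simp only [Module.Basis.coe_ofEquivFun]
    rw [LinearEquiv.eq_symm_apply]
    refine (mulVec_lattice_apply g coinvCoord _).trans ?_
    rw [Matrix.mulVec_mulVec, ← map_intCast_mul, h, Matrix.mulVec_single_one]
    ext j
    simp [Matrix.one_apply, Pi.single_apply]
  exact isPermutationLattice_of_basis _ _ _ _
    (key b _ (matHom_b ▸ coinvCoord_mul_matB_mul_coinvBasis))
    (key c _ (matHom_c ▸ coinvCoord_mul_matC_mul_coinvBasis))

end Lattice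

end CTwoCubed

/-! ### The obstruction modulo 2. -/

namespace CTwoCubed

/-- The generator of the image of `(n - 1) * (b - 1)` modulo `2`. -/
def socleVec : Fin 11 → ZMod 2 := ![0, 0, 0, 0, 1, 1, 1, 0, 0, 0, 0]

/-- The linear form with `(n - 1) * (b - 1) = socleVec * formB` modulo `2`. -/
def formB : Fin 11 → ZMod 2 := ![0, 1, 1, 1, 0, 0, 0, 0, 0, 0, 0]

/-- The linear form with `(n - 1) * (c - 1) = socleVec * formC` modulo `2`. -/
def formC : Fin 11 → ZMod 2 := ![0, 0, 1, 0, 0, 0, 0, 0, 0, 0, 0]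

/-- Reduction modulo `2` of an integral matrix. -/
abbrev modTwo (A : Matrix (Fin 11) (Fin 11) ℤ) : Matrix (Fin 11) (Fin 11) (ZMod 2) :=
  A.map Int.cast

/-- Signs disappear modulo 2, so the left side is `(n - 1)(b - 1)`. What matters is that `socleVec`
also serves for `c`. -/
theorem one_add_matN_mul_one_add_matB :
    1 + modTwo matN + modTwo matB + modTwo matN * modTwo matB =
      Matrix.vecMulVec socleVec formB := by decide +kernel

theorem one_add_matN_mul_one_add_matC :
    1 + modTwo matN + modTwo matC + modTwo matN * modTwo matC =
      Matrix.vecMulVec socleVec formC := by decide +kernel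

theorem formB_vecMul_matN : Matrix.vecMul formB (modTwo matN) = formB := by decide +kernel

theorem formB_vecMul_matB : Matrix.vecMul formB (modTwo matB) = formB := by decide +kernel

theorem formB_vecMul_matC : Matrix.vecMul formB (modTwo matC) = formB := by decide +kernel

theorem formC_vecMul_matN : Matrix.vecMul formC (modTwo matN) = formC := by decide +kernel

theorem formC_vecMul_matB : Matrix.vecMul formC (modTwo matB) = formC := by decide +kernel

theorem formC_vecMul_matC : Matrix.vecMul formC (modTwo matC) = formC := by decide +kernel

theorem sum_eq_smul_socleVec {A B : Matrix (Fin 11) (Fin 11) (ZMod 2)} {f : Fin 11 → ZMod 2}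
    (h : 1 + A + B + A * B = Matrix.vecMulVec socleVec f) (v : Fin 11 → ZMod 2) :
    v + A.mulVec v + B.mulVec v + A.mulVec (B.mulVec v) = (f ⬝ᵥ v) • socleVec := by
  have := congrArg (fun M => Matrix.mulVec M v) h
  simp only [Matrix.add_mulVec, Matrix.one_mulVec, ← Matrix.mulVec_mulVec,
    Matrix.vecMulVec_mulVec] at this
  rw [this]
  ext i
  simp [mul_comm]

/-- If a basis is permuted by two maps and `x` occurs in the support of
`e i + A (e i) + B (e i) + A (B (e i))`, then invariant functions agree at `x` and `i`. -/
theorem eq_of_repr_sum_ne_zero {ι K V X : Type*} [Semiring K] [AddCommMonoid V] [Module K V]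
    (e : Module.Basis ι K V) (σ τ : ι → ι) (p : ι → X) (hσ : ∀ i, p (σ i) = p i)
    (hτ : ∀ i, p (τ i) = p i) {i x : ι}
    (hx : e.repr (e i + e (σ i) + e (τ i) + e (σ (τ i))) x ≠ 0) : p x = p i := by
  classical
  by_contra hne
  have h1 : i ≠ x := fun h => hne (by rw [h])
  have h2 : σ i ≠ x := fun h => hne (by rw [← h, hσ])
  have h3 : τ i ≠ x := fun h => hne (by rw [← h, hτ])
  have h4 : σ (τ i) ≠ x := fun h => hne (by rw [← h, hσ, hτ])
  exact hx (by simp [h1, h2, h3, h4])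

/-- Modulo `2`, no basis is permuted by the three generators. -/
theorem not_permutes_basis_modTwo {ι : Type*} (e : Module.Basis ι (ZMod 2) (Fin 11 → ZMod 2))
    (σ τ υ : ι → ι) (hσ : ∀ i, (modTwo matN).mulVec (e i) = e (σ i))
    (hτ : ∀ i, (modTwo matB).mulVec (e i) = e (τ i))
    (hυ : ∀ i, (modTwo matC).mulVec (e i) = e (υ i)) : False := by
  let p : ι → ZMod 2 × ZMod 2 := fun i => (formB ⬝ᵥ e i, formC ⬝ᵥ e i)
  have pσ : ∀ i, p (σ i) = p i := fun i => by
    simp only [p, ← hσ, Matrix.dotProduct_mulVec, formB_vecMul_matN, formC_vecMul_matN]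
  have pτ : ∀ i, p (τ i) = p i := fun i => by
    simp only [p, ← hτ, Matrix.dotProduct_mulVec, formB_vecMul_matB, formC_vecMul_matB]
  have pυ : ∀ i, p (υ i) = p i := fun i => by
    simp only [p, ← hυ, Matrix.dotProduct_mulVec, formB_vecMul_matC, formC_vecMul_matC]
  -- The index `x` marks a basis vector in the support of `socleVec`; its orbit is the only one on
  -- which the forms can be nonzero.
  obtain ⟨x, hx⟩ : ∃ x, e.repr socleVec x ≠ 0 := by
    by_contra! h
    have : socleVec = 0 := by simpa using e.repr.map_eq_zero_iff.1 (Finsupp.ext h)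
    exact absurd this (by decide)
  have zero_or_one : ∀ a : ZMod 2, a = 0 ∨ a = 1 := by decide
  have hB : ∀ i, formB ⬝ᵥ e i = 1 → p x = p i := fun i hi => by
    refine eq_of_repr_sum_ne_zero e σ τ p pσ pτ ?_
    rw [← hσ (τ i), ← hσ i, ← hτ i, sum_eq_smul_socleVec one_add_matN_mul_one_add_matB, hi,
      one_smul]
    exact hx
  have hC : ∀ i, formC ⬝ᵥ e i = 1 → p x = p i := fun i hi => by
    refine eq_of_repr_sum_ne_zero e σ υ p pσ pυ ?_
    rw [← hσ (υ i), ← hσ i, ← hυ i, sum_eq_smul_socleVec one_add_matN_mul_one_add_matC, hi,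
      one_smul]
    exact hx
  have hp : ∀ i, p i = 0 ∨ p i = p x := fun i => by
    rcases zero_or_one (formB ⬝ᵥ e i) with h | h
    · rcases zero_or_one (formC ⬝ᵥ e i) with h' | h'
      · exact Or.inl (Prod.ext h h')
      · exact Or.inr (hC i h').symm
    · exact Or.inr (hB i h).symm
  have ext_form : ∀ f : Fin 11 → ZMod 2, (∀ i, f ⬝ᵥ e i = 0) → f = 0 := fun f hf =>
    dotProduct_eq_zero _ fun v => by
      have : dotProductBilin (ZMod 2) (ZMod 2) f = 0 := e.ext hf
      exact congrArg (fun l => l v) this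
  have eq_pair : ∀ i, formB ⬝ᵥ e i = (p i).1 ∧ formC ⬝ᵥ e i = (p i).2 := fun i => ⟨rfl, rfl⟩
  generalize p x = q at hp
  -- One of the three nonzero functionals on the plane over the field of two elements kills `q`; the
  -- matching form vanishes on the whole basis.
  have : ∀ q : ZMod 2 × ZMod 2, q.1 = 0 ∨ q.2 = 0 ∨ q.1 + q.2 = 0 := by decide
  rcases this q with h | h | h
  · refine absurd (ext_form formB fun i => ?_) (by decide)
    rcases hp i with hi | hi <;> simp [eq_pair, hi, h]
  · refine absurd (ext_form formC fun i => ?_) (by decide)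
    rcases hp i with hi | hi <;> simp [eq_pair, hi, h]
  · refine absurd (ext_form (formB + formC) fun i => ?_) (by decide)
    rcases hp i with hi | hi <;> simp [eq_pair, hi, h, add_dotProduct]

/-- The reduction of a basis of `R ^ m` along a ring homomorphism. -/
theorem exists_basis_map {R S m ι : Type*} [CommRing R] [CommRing S] [Fintype m] [DecidableEq m]
    [Fintype ι] [DecidableEq ι] (f : R →+* S) (e : Module.Basis ι R (m → R)) :
    ∃ e' : Module.Basis ι S (m → S), ∀ i, e' i = f ∘ e i := by
  -- The change-of-basis matrix and its inverse reduce entrywise to mutually inverse matrices over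
  -- `S`.
  let P := (Pi.basisFun R m).toMatrix e
  let Q := e.toMatrix (Pi.basisFun R m)
  have hPQ : P * Q = 1 := Module.Basis.toMatrix_mul_toMatrix_flip _ _
  have hQP : Q * P = 1 := Module.Basis.toMatrix_mul_toMatrix_flip _ _
  refine ⟨Module.Basis.ofEquivFun (Matrix.toLin'OfInv (M := P.map f) (M' := Q.map f)
    (by rw [← Matrix.map_mul, hPQ]; simp) (by rw [← Matrix.map_mul, hQP]; simp)), fun i => ?_⟩
  rw [Module.Basis.coe_ofEquivFun]
  refine (Matrix.toLin'_apply _ _).trans ?_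
  rw [Matrix.mulVec_single_one]
  rfl

theorem not_isPermutationLattice_lattice {k : Type*} [CommRing k] (f : k →+* ZMod 2) :
    ¬ IsPermutationLattice (lattice k) := by
  rintro ⟨r, e, he⟩
  obtain ⟨e', he'⟩ := exists_basis_map f e
  have key : ∀ g : CTwoCubed, ∃ σ : Fin r → Fin r,
      ∀ i, (modTwo (matHom g)).mulVec (e' i) = e' (σ i) := fun g => by
    choose σ hσ using he g
    refine ⟨σ, fun i => ?_⟩
    ext j
    rw [he', he', ← hσ, lattice_apply, Function.comp_apply, RingHom.map_mulVec, Matrix.map_map]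
    congr 2
    ext
    simp
  obtain ⟨σ, hσ⟩ := key n
  obtain ⟨τ, hτ⟩ := key b
  obtain ⟨υ, hυ⟩ := key c
  exact not_permutes_basis_modTwo e' σ τ υ (matHom_n ▸ hσ) (matHom_b ▸ hτ) (matHom_c ▸ hυ)

end CTwoCubed

theorem mainTheorem6 :
    (∃ ρ : Representation ℤ_[2] CTwoCubed (Fin 11 → ℤ_[2]),
      LinearMap.toMatrix' (ρ CTwoCubed.n) = CTwoCubed.matN.map (Int.cast : ℤ → ℤ_[2]) ∧
      LinearMap.toMatrix' (ρ CTwoCubed.b) = CTwoCubed.matB.map (Int.cast : ℤ → ℤ_[2]) ∧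
      LinearMap.toMatrix' (ρ CTwoCubed.c) = CTwoCubed.matC.map (Int.cast : ℤ → ℤ_[2]) ∧
      IsPermutationLattice (ρ.quotientToInvariants CTwoCubed.N) ∧
      IsPermutationLattice (ρ.quotientToCoinvariants CTwoCubed.N) ∧
      ¬ IsPermutationLattice ρ) ∧
    ¬ ∀ (V : Type) [AddCommGroup V] [Module ℤ_[2] V] [Module.Free ℤ_[2] V]
        [Module.Finite ℤ_[2] V] (ρ : Representation ℤ_[2] CTwoCubed V),
        IsPermutationLattice ρ ↔
          (IsPermutationLattice (ρ.quotientToInvariants CTwoCubed.N) ∧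
            IsPermutationLattice (ρ.quotientToCoinvariants CTwoCubed.N)) := by
  have hN := CTwoCubed.isPermutationLattice_quotientToInvariants (k := ℤ_[2])
  have hC := CTwoCubed.isPermutationLattice_quotientToCoinvariants (k := ℤ_[2])
  have hU := CTwoCubed.not_isPermutationLattice_lattice (PadicInt.toZMod (p := 2))
  refine ⟨⟨CTwoCubed.lattice ℤ_[2], ?_, ?_, ?_, hN, hC, hU⟩, fun h => hU ((h _ _).2 ⟨hN, hC⟩)⟩
  · rw [CTwoCubed.toMatrix'_lattice, CTwoCubed.matHom_n]
  · rw [CTwoCubed.toMatrix'_lattice, CTwoCubed.matHom_b]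
  · rw [CTwoCubed.toMatrix'_lattice, CTwoCubed.matHom_c]
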